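/- Let $s\mapsto(\xi(s),\eta(s))$, $s\in\mathbb R$, be the $C^\infty$ arc-length parametrization, periodic with period equal to the length of the curve, of a smooth strictly convex closed plane curve (a simple closed curve with nowhere vanishing curvature). Then there exists $c>0$, depending only on $\xi,\eta$, such that the following holds for every $T>0$ and every $T$-periodic $C^\infty$ function $\varphi:\mathbb R\to\mathbb R$ with $$|\dot\varphi(t)|<c,\qquad |\ddot\varphi(t)|<c\qquad\text{for all } t\in\mathbb R.$$ Let $s_1,s_2:\mathbb R\to\mathbb R$ be $C^\infty$ functions such that for all $t$ $$\xi'(s_1(t))\sin\varphi(t)+\eta'(s_1(t))\cos\varphi(t)=-1,\qquad \xi'(s_2(t))\sin\varphi(t)+\eta'(s_2(t))\cos\varphi(t)=1,\qquad s_1(t)<s_2(t)$$ (the two points of the curve, rotated by the angle $\varphi(t)$, where the tangent line is vertical). Then the equation of motion of a unit mass point sliding without friction along the rotating curve, that is, the Euler–Lagrange equation of the Lagrangian $\tfrac12\bigl(\dot s^2+\dot\varphi^2(\xi^2+\eta^2)+2\dot\varphi\dot s(\xi\eta'-\eta\xi')\bigr)+(\xi\sin\varphi+\eta\cos\varphi)$,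 $$\ddot s+\ddot\varphi\,(\xi\eta'-\eta\xi')-\dot\varphi^2(\xi\xi'+\eta\eta')-(\xi'\sin\varphi+\eta'\cos\varphi)=0$$ (with $\xi,\eta,\xi',\eta'$ evaluated at $s=s(t)$ and $\varphi,\dot\varphi,\ddot\varphi$ at $t$), has a $T$-periodic $C^\infty$ solution $s:\mathbb R\to\mathbb R$ with $$s_1(t)<s(t)<s_2(t)\qquad\text{for all } t\in\mathbb R.$$ -/

import Mathlib

open scoped ContDiff

/-- `s ↦ (ξ s, η s)` is the natural (arc length) parametrization, of period `ℓ`, of a smooth strictly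
convex closed plane curve: a smooth simple closed curve whose curvature vanishes nowhere. Both
orientations are allowed, and the origin (the centre of rotation) may lie anywhere. -/
structure IsStrictlyConvexClosedCurve (ξ η : ℝ → ℝ) (ℓ : ℝ) : Prop where
  length_pos : 0 < ℓ
  smooth_fst : ContDiff ℝ ∞ ξ
  smooth_snd : ContDiff ℝ ∞ η
  periodic_fst : Function.Periodic ξ ℓ
  periodic_snd : Function.Periodic η ℓ
  /-- The curve is simple. -/
  injOn : Set.InjOn (fun s => (ξ s, η s)) (Set.Ico 0 ℓ)
  /-- The parameter is the arc length. -/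
  unit_speed : ∀ s, deriv ξ s ^ 2 + deriv η s ^ 2 = 1
  /-- The curvature does not vanish. -/
  curvature_ne_zero :
    ∀ s, deriv ξ s * deriv (deriv η) s - deriv η s * deriv (deriv ξ) s ≠ 0

/-- The vertical component `ξ' sin φ + η' cos φ` of the unit tangent vector at the parameter `s`,
when the curve is rotated by the angle `φ`. -/
noncomputable def verticalSlope (ξ η : ℝ → ℝ) (φ s : ℝ) : ℝ :=
  deriv ξ s * Real.sin φ + deriv η s * Real.cos φ

/-- `s₁ < s₂` are smooth functions of time that give the two points of the rotating curve
where the tangent line is vertical: the vertical component of the unit tangent vector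
is `-1` at `s₁ t` and `1` at `s₂ t`. -/
structure IsVerticalTangentPair (ξ η φ s₁ s₂ : ℝ → ℝ) : Prop where
  smooth_left : ContDiff ℝ ∞ s₁
  smooth_right : ContDiff ℝ ∞ s₂
  left_eq : ∀ t, verticalSlope ξ η (φ t) (s₁ t) = -1
  right_eq : ∀ t, verticalSlope ξ η (φ t) (s₂ t) = 1
  lt : ∀ t, s₁ t < s₂ t

/-- `s` is a (smooth, global) solution of the equation of motion of a unit mass point on
the rotating curve under unit gravity. This is the Euler-Lagrange equation of `K - V`, where
`K = (s'² + φ'² (ξ² + η²) + 2 φ' s' (ξ η' - η ξ')) / 2` is the kinetic energy and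
`V = -(ξ sin φ + η cos φ)` is the potential. -/
def IsRotatingCurveSolution (ξ η φ s : ℝ → ℝ) : Prop :=
  ContDiff ℝ ∞ s ∧
    ∀ t, deriv (deriv s) t
        + deriv (deriv φ) t * (ξ (s t) * deriv η (s t) - η (s t) * deriv ξ (s t))
        - deriv φ t ^ 2 * (ξ (s t) * deriv ξ (s t) + η (s t) * deriv η (s t))
        - verticalSlope ξ η (φ t) (s t) = 0

/-!
Write the equation of motion as `s'' = f t s`. At a point where the tangent is vertical the gravity
term of `f` is `-1` (along `s₁`) or `1` (along `s₂`), and every other term of `f t sᵢ - sᵢ''`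
contains a factor `φ'²` or `φ''`. If the rotation is slow, gravity wins, so that `s₁` is a strict
lower and `s₂` a strict upper solution. Both are `T`-periodic: `φ` plus the tangent angle at `sᵢ` is
constant, and the tangent angle is an injective function of the arc length because the curvature
does not vanish. A periodic solution between a strict lower and a strict upper solution is the limit
of a monotone iteration, since the periodic resolvent of `1 - D² / m²` preserves the order and
`x ↦ x - f t x / m²` is increasing on bounded sets for large `m`.
-/

open MeasureTheory intervalIntegral Filter Topology Set

theorem exists_isFixedPt_of_monotoneOn_of_isSeqClosed {E : Type*} [ConditionallyCompleteLattice E]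
    [TopologicalSpace E] [SupConvergenceClass E] [T2Space E] {K : Set E} {S : E → E} {x : E}
    (hK : IsSeqClosed K) (hbdd : BddAbove K) (hmaps : MapsTo S K K) (hmono : MonotoneOn S K)
    (hcont : ∀ (u : ℕ → E) (v : E), (∀ n, u n ∈ K) → v ∈ K → Tendsto u atTop (𝓝 v) →
      Tendsto (fun n => S (u n)) atTop (𝓝 (S v)))
    (hx : x ∈ K) (hxS : x ≤ S x) : ∃ v ∈ K, Function.IsFixedPt S v := by
  have hmem (n : ℕ) : S^[n] x ∈ K := hmaps.iterate n hx
  have hsucc (n : ℕ) : S^[n + 1] x = S (S^[n] x) := Function.iterate_succ_apply' S n x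
  have hiter : Monotone fun n => S^[n] x := monotone_nat_of_le_succ fun n => by
    induction n with
    | zero => exact hxS
    | succ n ih =>
      rw [hsucc n, hsucc (n + 1)]
      exact hmono (hmem n) (hmem (n + 1)) ih
  have hlim : Tendsto (fun n => S^[n] x) atTop (𝓝 (⨆ n, S^[n] x)) :=
    tendsto_atTop_ciSup hiter (hbdd.mono (range_subset_iff.2 hmem))
  have hsup : ⨆ n, S^[n] x ∈ K := hK hmem hlim
  refine ⟨_, hsup, tendsto_nhds_unique (hcont _ _ hmem hsup hlim) ?_⟩
  simpa only [hsucc] using (tendsto_add_atTop_iff_nat 1).2 hlim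

theorem lt_of_periodic_of_deriv_deriv_sub_lt {T M : ℝ} {u v : ℝ → ℝ} (hT : T ≠ 0) (hM : 0 ≤ M)
    (hu : ContDiff ℝ 2 u) (hv : ContDiff ℝ 2 v) (hup : Function.Periodic u T)
    (hvp : Function.Periodic v T)
    (h : ∀ t, deriv (deriv v) t - M * v t < deriv (deriv u) t - M * u t) (t : ℝ) : u t < v t := by
  have hz : Continuous (u - v) := hu.continuous.sub hv.continuous
  obtain ⟨_, ⟨t₀, rfl⟩, hmax⟩ :=
    ((hup.sub hvp).compact_of_continuous hT hz).exists_isGreatest (range_nonempty _)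
  have hle (s : ℝ) : (u - v) s ≤ (u - v) t₀ := hmax (mem_range_self s)
  suffices (u - v) t₀ < 0 from sub_neg.1 ((hle t).trans_lt this)
  by_contra! hnonneg
  have hderiv2 : deriv (deriv (u - v)) t₀ = deriv (deriv u) t₀ - deriv (deriv v) t₀ := by
    rw [show deriv (u - v) = deriv u - deriv v from funext fun s =>
      deriv_sub (hu.differentiable two_ne_zero s) (hv.differentiable two_ne_zero s)]
    exact deriv_sub (hu.differentiable_deriv_two t₀) (hv.differentiable_deriv_two t₀)
  have hpos : 0 < deriv (deriv (u - v)) t₀ := by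
    have := mul_nonneg hM hnonneg
    rw [Pi.sub_apply, mul_sub] at this
    linarith [h t₀]
  have hlocMax : IsLocalMax (u - v) t₀ := Eventually.of_forall hle
  have hlocMin : IsLocalMin (u - v) t₀ :=
    isLocalMin_of_deriv_deriv_pos hpos hlocMax.deriv_eq_zero hz.continuousAt
  have hconst : u - v =ᶠ[𝓝 t₀] fun _ => (u - v) t₀ :=
    hlocMin.mono fun s hs => le_antisymm (hle s) hs
  have hzero : deriv (deriv (u - v)) t₀ = 0 := by
    simpa only [deriv_const', deriv_const] using hconst.deriv.deriv_eq
  exact hpos.ne' hzero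

/-- The exponentially weighted average of `h` over `[t, t + T]`. For a `T`-periodic `h` and `a ≠ 0`
it is the `T`-periodic solution `u` of `u' = a (h - u)`. -/
noncomputable def expAverage (a T : ℝ) (h : ℝ → ℝ) (t : ℝ) : ℝ :=
  a / (Real.exp (a * T) - 1) * ∫ r in (0 : ℝ)..T, Real.exp (a * r) * h (t + r)

section ExpAverage

variable {a T : ℝ} {h k : ℝ → ℝ}

theorem exp_mul_sub_one_ne_zero (ha : a ≠ 0) (hT : T ≠ 0) : Real.exp (a * T) - 1 ≠ 0 := by
  rw [sub_ne_zero, Ne, Real.exp_eq_one_iff]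
  exact mul_ne_zero ha hT

theorem div_exp_mul_sub_one_nonneg (a : ℝ) (hT : 0 ≤ T) : 0 ≤ a / (Real.exp (a * T) - 1) := by
  rcases le_total 0 a with ha | ha
  · exact div_nonneg ha (sub_nonneg.2 (Real.one_le_exp (mul_nonneg ha hT)))
  · exact div_nonneg_of_nonpos ha
      (sub_nonpos.2 (Real.exp_le_one_iff.2 (mul_nonpos_of_nonpos_of_nonneg ha hT)))

theorem intervalIntegrable_exp_mul (hh : LocallyIntegrable h) (a x y : ℝ) :
    IntervalIntegrable (fun r => Real.exp (a * r) * h r) volume x y :=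
  (hh.integrableOn_isCompact isCompact_uIcc).intervalIntegrable.continuousOn_mul
    (Continuous.continuousOn (by fun_prop))

theorem intervalIntegrable_exp_mul_comp_add (hh : LocallyIntegrable h) (a T t : ℝ) :
    IntervalIntegrable (fun r => Real.exp (a * r) * h (t + r)) volume 0 T := by
  have : IntervalIntegrable h volume (t + 0) (t + T) :=
    (hh.integrableOn_isCompact isCompact_uIcc).intervalIntegrable
  refine IntervalIntegrable.continuousOn_mul ?_ (Continuous.continuousOn (by fun_prop))
  simpa using this.comp_add_left t

theorem expAverage_mono (hT : 0 ≤ T) (hh : LocallyIntegrable h) (hk : LocallyIntegrable k)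
    (hhk : h ≤ k) : expAverage a T h ≤ expAverage a T k := fun t =>
  mul_le_mul_of_nonneg_left
    (integral_mono_on hT (intervalIntegrable_exp_mul_comp_add hh a T t)
      (intervalIntegrable_exp_mul_comp_add hk a T t)
      fun r _ => mul_le_mul_of_nonneg_left (hhk (t + r)) (Real.exp_nonneg _))
    (div_exp_mul_sub_one_nonneg a hT)

theorem expAverage_const (ha : a ≠ 0) (hT : T ≠ 0) (c : ℝ) :
    expAverage a T (fun _ => c) = fun _ => c := by
  have hexp : Real.exp (a * T) - 1 ≠ 0 := exp_mul_sub_one_ne_zero ha hT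
  funext t
  rw [expAverage, intervalIntegral.integral_mul_const,
    intervalIntegral.integral_comp_mul_left _ ha, integral_exp, mul_zero, Real.exp_zero,
    smul_eq_mul]
  field_simp

theorem abs_expAverage_le (ha : a ≠ 0) (hT : 0 < T) (hh : LocallyIntegrable h) {C : ℝ}
    (hC : ∀ t, |h t| ≤ C) (t : ℝ) : |expAverage a T h t| ≤ C := by
  have hlower : expAverage a T (fun _ => -C) ≤ expAverage a T h :=
    expAverage_mono hT.le (locallyIntegrable_const _) hh fun s => (abs_le.1 (hC s)).1
  have hupper : expAverage a T h ≤ expAverage a T fun _ => C :=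
    expAverage_mono hT.le hh (locallyIntegrable_const _) fun s => (abs_le.1 (hC s)).2
  rw [expAverage_const ha hT.ne'] at hlower hupper
  exact abs_le.2 ⟨hlower t, hupper t⟩

theorem periodic_expAverage (hp : Function.Periodic h T) :
    Function.Periodic (expAverage a T h) T := fun t => by
  simp only [expAverage, add_right_comm t T, hp _]

theorem tendsto_expAverage {u : ℕ → ℝ → ℝ} (hu : ∀ n, LocallyIntegrable (u n)) {C : ℝ}
    (hC : ∀ n t, |u n t| ≤ C) (hlim : Tendsto u atTop (𝓝 h)) :
    Tendsto (fun n => expAverage a T (u n)) atTop (𝓝 (expAverage a T h)) := by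
  refine tendsto_pi_nhds.2 fun t => Tendsto.const_mul _ ?_
  refine tendsto_integral_filter_of_dominated_convergence (fun r => Real.exp (a * r) * C)
    (Eventually.of_forall fun n => ?_)
    (Eventually.of_forall fun n => Eventually.of_forall fun r _ => ?_)
    (Continuous.intervalIntegrable (by fun_prop) 0 T) (Eventually.of_forall fun r _ => ?_)
  · exact (intervalIntegrable_iff.1
      (intervalIntegrable_exp_mul_comp_add (hu n) a T t)).aestronglyMeasurable
  · rw [Real.norm_eq_abs, abs_mul, Real.abs_exp]
    exact mul_le_mul_of_nonneg_left (hC n _) (Real.exp_nonneg _)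
  · exact (tendsto_pi_nhds.1 hlim (t + r)).const_mul _

theorem expAverage_eq_primitive (hh : LocallyIntegrable h) (t : ℝ) :
    expAverage a T h t = a / (Real.exp (a * T) - 1) * (Real.exp (-(a * t)) *
      ((∫ r in (0 : ℝ)..t + T, Real.exp (a * r) * h r) -
        ∫ r in (0 : ℝ)..t, Real.exp (a * r) * h r)) := by
  have hint := intervalIntegrable_exp_mul hh a
  have hshift (r : ℝ) : Real.exp (a * r) * h (t + r) =
      Real.exp (-(a * t)) * (Real.exp (a * (t + r)) * h (t + r)) := by
    rw [← mul_assoc, ← Real.exp_add]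
    ring_nf
  rw [integral_interval_sub_left (hint _ _) (hint _ _), expAverage,
    integral_congr fun r _ => hshift r, intervalIntegral.integral_const_mul,
    integral_comp_add_left (fun r => Real.exp (a * r) * h r), add_zero]

theorem continuous_expAverage (hh : LocallyIntegrable h) : Continuous (expAverage a T h) := by
  have hprim : Continuous fun t => ∫ r in (0 : ℝ)..t, Real.exp (a * r) * h r :=
    continuous_primitive (intervalIntegrable_exp_mul hh a) 0
  rw [funext (expAverage_eq_primitive hh)]
  exact continuous_const.mul ((by fun_prop : Continuous fun t => Real.exp (-(a * t))).mul
    ((hprim.comp (continuous_add_const T)).sub hprim))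

theorem hasDerivAt_expAverage (ha : a ≠ 0) (hT : T ≠ 0) (hh : Continuous h)
    (hp : Function.Periodic h T) (t : ℝ) :
    HasDerivAt (expAverage a T h) (a * (h t - expAverage a T h t)) t := by
  have hweight : a / (Real.exp (a * T) - 1) * (Real.exp (a * T) - 1) = a :=
    div_mul_cancel₀ a (exp_mul_sub_one_ne_zero ha hT)
  have hprim (t : ℝ) : HasDerivAt (fun t => ∫ r in (0 : ℝ)..t, Real.exp (a * r) * h r)
      (Real.exp (a * t) * h t) t := by
    have hcont : Continuous fun r => Real.exp (a * r) * h r := by fun_prop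
    exact hcont.integral_hasStrictDerivAt 0 t |>.hasDerivAt
  have hdecay : HasDerivAt (fun t => Real.exp (-(a * t))) (Real.exp (-(a * t)) * -a) t := by
    simpa using ((hasDerivAt_id t).const_mul a).neg.exp
  have hcancel : Real.exp (-(a * t)) * Real.exp (a * t) = 1 := by
    rw [← Real.exp_add, neg_add_cancel, Real.exp_zero]
  have hcancel' : Real.exp (-(a * t)) * Real.exp (a * (t + T)) = Real.exp (a * T) := by
    rw [← Real.exp_add]
    ring_nf
  rw [expAverage_eq_primitive hh.locallyIntegrable,
    funext (expAverage_eq_primitive hh.locallyIntegrable)]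
  refine ((hdecay.mul (((hprim (t + T)).comp_add_const t T).sub (hprim t))).const_mul
    (a / (Real.exp (a * T) - 1))).congr_deriv ?_
  rw [hp t, Pi.sub_apply]
  linear_combination h t * (a / (Real.exp (a * T) - 1)) * (hcancel' - hcancel) + h t * hweight

end ExpAverage

/-- The resolvent of the periodic problem: for a `T`-periodic `h` and `m ≠ 0` it is the
`T`-periodic solution `u` of `u - u'' / m² = h`. The factorization
`1 - D² / m² = (1 - D / m) (1 + D / m)` of the differential operator reduces it to two exponential
averages. -/
noncomputable def periodicResolvent (m T : ℝ) (h : ℝ → ℝ) : ℝ → ℝ :=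
  expAverage (-m) T (expAverage m T h)

section PeriodicResolvent

variable {m T : ℝ} {h k : ℝ → ℝ}

theorem periodicResolvent_mono (hT : 0 ≤ T) (hh : LocallyIntegrable h) (hk : LocallyIntegrable k)
    (hhk : h ≤ k) : periodicResolvent m T h ≤ periodicResolvent m T k :=
  expAverage_mono hT (continuous_expAverage hh).locallyIntegrable
    (continuous_expAverage hk).locallyIntegrable (expAverage_mono hT hh hk hhk)

theorem periodic_periodicResolvent (hp : Function.Periodic h T) :
    Function.Periodic (periodicResolvent m T h) T :=
  periodic_expAverage (periodic_expAverage hp)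

theorem continuous_periodicResolvent (hh : LocallyIntegrable h) :
    Continuous (periodicResolvent m T h) :=
  continuous_expAverage (continuous_expAverage hh).locallyIntegrable

theorem tendsto_periodicResolvent (hm : m ≠ 0) (hT : 0 < T) {u : ℕ → ℝ → ℝ}
    (hu : ∀ n, LocallyIntegrable (u n)) {C : ℝ} (hC : ∀ n t, |u n t| ≤ C)
    (hlim : Tendsto u atTop (𝓝 h)) :
    Tendsto (fun n => periodicResolvent m T (u n)) atTop (𝓝 (periodicResolvent m T h)) :=
  tendsto_expAverage (fun n => (continuous_expAverage (hu n)).locallyIntegrable)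
    (fun n => abs_expAverage_le hm hT (hu n) (hC n)) (tendsto_expAverage hu hC hlim)

theorem deriv_periodicResolvent (hm : m ≠ 0) (hT : T ≠ 0) (hh : Continuous h)
    (hp : Function.Periodic h T) :
    deriv (periodicResolvent m T h) =
      fun t => m * (periodicResolvent m T h t - expAverage m T h t) := by
  funext t
  refine ((hasDerivAt_expAverage (neg_ne_zero.2 hm) hT
    (continuous_expAverage hh.locallyIntegrable) (periodic_expAverage hp) t).congr_deriv ?_).deriv
  rw [periodicResolvent]
  ring

theorem hasDerivAt_deriv_periodicResolvent (hm : m ≠ 0) (hT : T ≠ 0) (hh : Continuous h)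
    (hp : Function.Periodic h T) (t : ℝ) :
    HasDerivAt (deriv (periodicResolvent m T h)) (m ^ 2 * (periodicResolvent m T h t - h t)) t := by
  rw [deriv_periodicResolvent hm hT hh hp]
  refine (((hasDerivAt_expAverage (neg_ne_zero.2 hm) hT
    (continuous_expAverage hh.locallyIntegrable) (periodic_expAverage hp) t).sub
      (hasDerivAt_expAverage hm hT hh hp t)).const_mul m).congr_deriv ?_
  rw [periodicResolvent]
  ring

theorem contDiff_periodicResolvent (hm : m ≠ 0) (hT : T ≠ 0) (hh : Continuous h)
    (hp : Function.Periodic h T) : ContDiff ℝ 2 (periodicResolvent m T h) := by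
  have hderiv := hasDerivAt_deriv_periodicResolvent hm hT hh hp
  have hC1 : ContDiff ℝ 1 (deriv (periodicResolvent m T h)) :=
    contDiff_one_iff_deriv.2 ⟨fun t => (hderiv t).differentiableAt, by
      rw [funext fun t => (hderiv t).deriv]
      exact continuous_const.mul ((continuous_periodicResolvent hh.locallyIntegrable).sub hh)⟩
  refine (contDiff_succ_iff_deriv (n := 1)).2 ⟨fun t => ?_, by simp, hC1⟩
  exact (hasDerivAt_expAverage (neg_ne_zero.2 hm) hT (continuous_expAverage hh.locallyIntegrable)
    (periodic_expAverage hp) t).differentiableAt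

end PeriodicResolvent

/-- A strict lower solution of the `T`-periodic problem `u'' = f t u`. -/
structure IsStrictLowerSolution (T : ℝ) (f : ℝ → ℝ → ℝ) (α : ℝ → ℝ) : Prop where
  contDiff : ContDiff ℝ 2 α
  periodic : Function.Periodic α T
  lt_deriv_deriv : ∀ t, f t (α t) < deriv (deriv α) t

/-- A strict upper solution of the `T`-periodic problem `u'' = f t u`. -/
structure IsStrictUpperSolution (T : ℝ) (f : ℝ → ℝ → ℝ) (β : ℝ → ℝ) : Prop where
  contDiff : ContDiff ℝ 2 β
  periodic : Function.Periodic β T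
  deriv_deriv_lt : ∀ t, deriv (deriv β) t < f t (β t)

/-- The right-hand side of `u - u'' / m² = u - f t u / m²`, an equivalent form of `u'' = f t u`. For
large `m` it is increasing in `u` on bounded sets, which makes the iteration scheme monotone. -/
noncomputable def relaxedForce (m : ℝ) (f : ℝ → ℝ → ℝ) (t x : ℝ) : ℝ :=
  x - f t x / m ^ 2

/-- One step `u ↦ v` of the monotone iteration for `u'' = f t u`, where `v` is the periodic solution
of `v - v'' / m² = relaxedForce m f t u`. -/
noncomputable def iterationStep (m T : ℝ) (f : ℝ → ℝ → ℝ) (u : ℝ → ℝ) : ℝ → ℝ :=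
  periodicResolvent m T fun t => relaxedForce m f t (u t)

/-- The domain of the monotone iteration. Pointwise limits of continuous functions need only be
measurable, so continuity is not required. -/
def measurablePeriodicIcc (T : ℝ) (α β : ℝ → ℝ) : Set (ℝ → ℝ) :=
  {u | Measurable u ∧ Function.Periodic u T} ∩ Icc α β

section MonotoneIteration

variable {m T : ℝ} {f : ℝ → ℝ → ℝ} {α β u v : ℝ → ℝ}

theorem isSeqClosed_measurablePeriodicIcc : IsSeqClosed (measurablePeriodicIcc T α β) := by
  intro u v hu hlim
  refine ⟨⟨measurable_of_tendsto_metrizable (fun n => (hu n).1.1) hlim, fun t => ?_⟩,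
    isClosed_Icc.isSeqClosed (fun n => (hu n).2) hlim⟩
  refine tendsto_nhds_unique (tendsto_pi_nhds.1 hlim (t + T)) ?_
  simpa only [(hu _).1.2 t] using tendsto_pi_nhds.1 hlim t

theorem IsStrictLowerSolution.mem_measurablePeriodicIcc (hα : IsStrictLowerSolution T f α)
    (hαβ : α ≤ β) : α ∈ measurablePeriodicIcc T α β :=
  ⟨⟨hα.contDiff.continuous.measurable, hα.periodic⟩, le_rfl, hαβ⟩

theorem IsStrictUpperSolution.mem_measurablePeriodicIcc (hβ : IsStrictUpperSolution T f β)
    (hαβ : α ≤ β) : β ∈ measurablePeriodicIcc T α β :=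
  ⟨⟨hβ.contDiff.continuous.measurable, hβ.periodic⟩, hαβ, le_rfl⟩

theorem exists_monotoneOn_relaxedForce (hT : 0 < T) (hf : ContDiff ℝ 1 (Function.uncurry f))
    (hfp : Function.Periodic f T) (hα : Continuous α) (hβ : Continuous β)
    (hαp : Function.Periodic α T) (hβp : Function.Periodic β T) :
    ∃ m ≠ 0, ∀ t, MonotoneOn (relaxedForce m f t) (Icc (α t) (β t)) := by
  obtain ⟨A, hA⟩ := (hαp.compact_of_continuous hT.ne' hα).bddBelow
  obtain ⟨B, hB⟩ := (hβp.compact_of_continuous hT.ne' hβ).bddAbove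
  obtain ⟨L, hL⟩ := (hf.contDiffOn (s := Icc 0 T ×ˢ Icc A B)).exists_lipschitzOnWith one_ne_zero
    ((convex_Icc _ _).prod (convex_Icc _ _)) (isCompact_Icc.prod isCompact_Icc)
  have hm : (0 : ℝ) < L + 1 := by positivity
  refine ⟨L + 1, hm.ne', fun t x hx y hy hxy => ?_⟩
  obtain ⟨τ, hτ, hfτ⟩ := hfp.exists_mem_Ico₀ hT t
  have hmem {z : ℝ} (hz : z ∈ Icc (α t) (β t)) : (τ, z) ∈ Icc 0 T ×ˢ Icc A B :=
    ⟨Ico_subset_Icc_self hτ, (hA (mem_range_self t)).trans hz.1, hz.2.trans (hB (mem_range_self t))⟩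
  have hlip : |f t y - f t x| ≤ L * (y - x) := by
    have := hL.dist_le_mul _ (hmem hy) _ (hmem hx)
    rwa [Function.uncurry_apply_pair, Function.uncurry_apply_pair, ← hfτ, Real.dist_eq,
      Prod.dist_eq, dist_self, max_eq_right dist_nonneg, Real.dist_eq,
      abs_of_nonneg (sub_nonneg.2 hxy)] at this
  have hslope : (f t y - f t x) / (L + 1) ^ 2 ≤ y - x := by
    rw [div_le_iff₀ (pow_pos hm 2)]
    calc f t y - f t x ≤ L * (y - x) := (le_abs_self _).trans hlip
      _ ≤ (L + 1) ^ 2 * (y - x) := by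
        gcongr
        nlinarith [L.coe_nonneg]
      _ = (y - x) * (L + 1) ^ 2 := mul_comm _ _
  rw [sub_div] at hslope
  simp only [relaxedForce]
  linarith

theorem continuous_relaxedForce (hf : Continuous (Function.uncurry f)) (m : ℝ) :
    Continuous (Function.uncurry (relaxedForce m f)) :=
  continuous_snd.sub (hf.div_const _)

theorem periodic_relaxedForce_comp (hfp : Function.Periodic f T) (hu : Function.Periodic u T) :
    Function.Periodic (fun t => relaxedForce m f t (u t)) T := fun t => by
  simp only [relaxedForce, hfp t, hu t]

theorem continuous_relaxedForce_comp (hf : Continuous (Function.uncurry f)) (hu : Continuous u) :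
    Continuous fun t => relaxedForce m f t (u t) :=
  (continuous_relaxedForce hf m).comp (continuous_id.prodMk hu)

theorem exists_abs_relaxedForce_le (hT : T ≠ 0) (hf : Continuous (Function.uncurry f))
    (hfp : Function.Periodic f T) (hα : Continuous α) (hβ : Continuous β)
    (hαp : Function.Periodic α T) (hβp : Function.Periodic β T)
    (hmono : ∀ t, MonotoneOn (relaxedForce m f t) (Icc (α t) (β t))) :
    ∃ C, ∀ u ∈ Icc α β, ∀ t, |relaxedForce m f t (u t)| ≤ C := by
  obtain ⟨A, hA⟩ := ((periodic_relaxedForce_comp hfp hαp).compact_of_continuous hT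
    (continuous_relaxedForce_comp (m := m) hf hα)).bddBelow
  obtain ⟨B, hB⟩ := ((periodic_relaxedForce_comp hfp hβp).compact_of_continuous hT
    (continuous_relaxedForce_comp (m := m) hf hβ)).bddAbove
  refine ⟨max |A| |B|, fun u hu t => abs_le_max_abs_abs ?_ ?_⟩
  · exact (hA (mem_range_self t)).trans
      (hmono t ⟨le_rfl, (hu.1 t).trans (hu.2 t)⟩ ⟨hu.1 t, hu.2 t⟩ (hu.1 t))
  · exact (hmono t ⟨hu.1 t, hu.2 t⟩ ⟨(hu.1 t).trans (hu.2 t), le_rfl⟩ (hu.2 t)).trans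
      (hB (mem_range_self t))

theorem locallyIntegrable_relaxedForce_comp (hf : Continuous (Function.uncurry f))
    (hu : Measurable u) {C : ℝ} (hC : ∀ t, |relaxedForce m f t (u t)| ≤ C) :
    LocallyIntegrable fun t => relaxedForce m f t (u t) := by
  have hmeas : Measurable fun t => relaxedForce m f t (u t) :=
    (continuous_relaxedForce hf m).measurable.comp (measurable_id.prodMk hu)
  exact (locallyIntegrable_const C).mono hmeas.aestronglyMeasurable
    (Eventually.of_forall fun t => (hC t).trans (le_abs_self C))

theorem deriv_deriv_iterationStep (hm : m ≠ 0) (hT : T ≠ 0) (hf : Continuous (Function.uncurry f))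
    (hfp : Function.Periodic f T) (hu : Continuous u) (hup : Function.Periodic u T) (t : ℝ) :
    deriv (deriv (iterationStep m T f u)) t =
      m ^ 2 * (iterationStep m T f u t - u t) + f t (u t) := by
  rw [iterationStep, (hasDerivAt_deriv_periodicResolvent hm hT
    (continuous_relaxedForce_comp hf hu) (periodic_relaxedForce_comp hfp hup) t).deriv,
    relaxedForce]
  field_simp
  ring

theorem contDiff_iterationStep (hm : m ≠ 0) (hT : T ≠ 0) (hf : Continuous (Function.uncurry f))
    (hfp : Function.Periodic f T) (hu : Continuous u) (hup : Function.Periodic u T) :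
    ContDiff ℝ 2 (iterationStep m T f u) :=
  contDiff_periodicResolvent hm hT (continuous_relaxedForce_comp hf hu)
    (periodic_relaxedForce_comp hfp hup)

theorem periodic_iterationStep (hfp : Function.Periodic f T) (hup : Function.Periodic u T) :
    Function.Periodic (iterationStep m T f u) T :=
  periodic_periodicResolvent (periodic_relaxedForce_comp hfp hup)

theorem IsStrictLowerSolution.lt_iterationStep (hα : IsStrictLowerSolution T f α) (hm : m ≠ 0)
    (hT : T ≠ 0) (hf : Continuous (Function.uncurry f)) (hfp : Function.Periodic f T) (t : ℝ) :
    α t < iterationStep m T f α t := by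
  refine lt_of_periodic_of_deriv_deriv_sub_lt hT (sq_nonneg m) hα.contDiff
    (contDiff_iterationStep hm hT hf hfp hα.contDiff.continuous hα.periodic) hα.periodic
    (periodic_iterationStep hfp hα.periodic) (fun s => ?_) t
  rw [deriv_deriv_iterationStep hm hT hf hfp hα.contDiff.continuous hα.periodic]
  linarith [hα.lt_deriv_deriv s]

theorem IsStrictUpperSolution.iterationStep_lt (hβ : IsStrictUpperSolution T f β) (hm : m ≠ 0)
    (hT : T ≠ 0) (hf : Continuous (Function.uncurry f)) (hfp : Function.Periodic f T) (t : ℝ) :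
    iterationStep m T f β t < β t := by
  refine lt_of_periodic_of_deriv_deriv_sub_lt hT (sq_nonneg m)
    (contDiff_iterationStep hm hT hf hfp hβ.contDiff.continuous hβ.periodic) hβ.contDiff
    (periodic_iterationStep hfp hβ.periodic) hβ.periodic (fun s => ?_) t
  rw [deriv_deriv_iterationStep hm hT hf hfp hβ.contDiff.continuous hβ.periodic]
  linarith [hβ.deriv_deriv_lt s]

theorem monotoneOn_iterationStep (hT : 0 ≤ T) (hf : Continuous (Function.uncurry f))
    (hmono : ∀ t, MonotoneOn (relaxedForce m f t) (Icc (α t) (β t))) {C : ℝ}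
    (hC : ∀ u ∈ Icc α β, ∀ t, |relaxedForce m f t (u t)| ≤ C) :
    MonotoneOn (iterationStep m T f) (measurablePeriodicIcc T α β) := fun u hu v hv huv =>
  periodicResolvent_mono hT (locallyIntegrable_relaxedForce_comp hf hu.1.1 (hC u hu.2))
    (locallyIntegrable_relaxedForce_comp hf hv.1.1 (hC v hv.2))
    fun t => hmono t ⟨hu.2.1 t, hu.2.2 t⟩ ⟨hv.2.1 t, hv.2.2 t⟩ (huv t)

theorem tendsto_iterationStep (hm : m ≠ 0) (hT : 0 < T) (hf : Continuous (Function.uncurry f))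
    {C : ℝ} (hC : ∀ u ∈ Icc α β, ∀ t, |relaxedForce m f t (u t)| ≤ C) {w : ℕ → ℝ → ℝ}
    (hw : ∀ n, w n ∈ measurablePeriodicIcc T α β) (hlim : Tendsto w atTop (𝓝 v)) :
    Tendsto (fun n => iterationStep m T f (w n)) atTop (𝓝 (iterationStep m T f v)) := by
  refine tendsto_periodicResolvent hm hT
    (fun n => locallyIntegrable_relaxedForce_comp hf (hw n).1.1 (hC _ (hw n).2))
    (fun n => hC _ (hw n).2) (tendsto_pi_nhds.2 fun t => ?_)
  have hcont : Continuous (relaxedForce m f t) :=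
    (continuous_relaxedForce hf m).comp (Continuous.prodMk_right t)
  exact (hcont.tendsto (v t)).comp (tendsto_pi_nhds.1 hlim t)

theorem mapsTo_iterationStep (hm : m ≠ 0) (hT : 0 < T) (hf : Continuous (Function.uncurry f))
    (hfp : Function.Periodic f T) (hα : IsStrictLowerSolution T f α)
    (hβ : IsStrictUpperSolution T f β) (hαβ : α ≤ β)
    (hmono : ∀ t, MonotoneOn (relaxedForce m f t) (Icc (α t) (β t))) {C : ℝ}
    (hC : ∀ u ∈ Icc α β, ∀ t, |relaxedForce m f t (u t)| ≤ C) :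
    MapsTo (iterationStep m T f) (measurablePeriodicIcc T α β) (measurablePeriodicIcc T α β) := by
  intro u hu
  have hS := monotoneOn_iterationStep hT.le hf hmono hC
  refine ⟨⟨(continuous_periodicResolvent (locallyIntegrable_relaxedForce_comp hf hu.1.1
    (hC u hu.2))).measurable, periodic_iterationStep hfp hu.1.2⟩, ?_, ?_⟩
  · exact le_trans (fun t => (hα.lt_iterationStep hm hT.ne' hf hfp t).le)
      (hS (hα.mem_measurablePeriodicIcc hαβ) hu hu.2.1)
  · exact le_trans (hS hu (hβ.mem_measurablePeriodicIcc hαβ) hu.2.2)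
      fun t => (hβ.iterationStep_lt hm hT.ne' hf hfp t).le

theorem exists_periodic_solution_between (hT : 0 < T) (hf : ContDiff ℝ 1 (Function.uncurry f))
    (hfp : Function.Periodic f T) (hα : IsStrictLowerSolution T f α)
    (hβ : IsStrictUpperSolution T f β) (hαβ : α ≤ β) :
    ∃ u, ContDiff ℝ 2 u ∧ (∀ t, deriv (deriv u) t = f t (u t)) ∧ Function.Periodic u T ∧
      ∀ t, α t < u t ∧ u t < β t := by
  have hfc : Continuous (Function.uncurry f) := hf.continuous
  obtain ⟨m, hm, hmono⟩ := exists_monotoneOn_relaxedForce hT hf hfp hα.contDiff.continuous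
    hβ.contDiff.continuous hα.periodic hβ.periodic
  obtain ⟨C, hC⟩ := exists_abs_relaxedForce_le hT.ne' hfc hfp hα.contDiff.continuous
    hβ.contDiff.continuous hα.periodic hβ.periodic hmono
  have hS := monotoneOn_iterationStep hT.le hfc hmono hC
  have hαK := hα.mem_measurablePeriodicIcc hαβ
  have hβK := hβ.mem_measurablePeriodicIcc hαβ
  have hαS := hα.lt_iterationStep hm hT.ne' hfc hfp
  have hβS := hβ.iterationStep_lt hm hT.ne' hfc hfp
  obtain ⟨u, hu, hfix⟩ := exists_isFixedPt_of_monotoneOn_of_isSeqClosed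
    isSeqClosed_measurablePeriodicIcc ⟨β, fun _ hw => hw.2.2⟩
    (mapsTo_iterationStep hm hT hfc hfp hα hβ hαβ hmono hC) hS
    (fun _ _ hw _ hlim => tendsto_iterationStep hm hT hfc hC hw hlim) hαK fun t => (hαS t).le
  have huc : Continuous u := by
    rw [← hfix.eq]
    exact continuous_periodicResolvent (locallyIntegrable_relaxedForce_comp hfc hu.1.1 (hC u hu.2))
  refine ⟨u, ?_, fun t => ?_, hu.1.2, fun t => ⟨?_, ?_⟩⟩
  · rw [← hfix.eq]
    exact contDiff_iterationStep hm hT.ne' hfc hfp huc hu.1.2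
  · simpa only [hfix.eq, sub_self, mul_zero, zero_add] using
      deriv_deriv_iterationStep hm hT.ne' hfc hfp huc hu.1.2 t
  · calc α t < iterationStep m T f α t := hαS t
      _ ≤ iterationStep m T f u t := hS hαK hu hu.2.1 t
      _ = u t := congrFun hfix t
  · calc u t = iterationStep m T f u t := (congrFun hfix t).symm
      _ ≤ iterationStep m T f β t := hS hu hβK hu.2.2 t
      _ < β t := hβS t

end MonotoneIteration

theorem contDiff_infty_of_deriv_deriv_eq {E : Type*} [NormedAddCommGroup E] [NormedSpace ℝ E]
    {f : ℝ → E → E} {u : ℝ → E} (hf : ContDiff ℝ ∞ (Function.uncurry f)) (hu : ContDiff ℝ 2 u)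
    (hode : ∀ t, deriv (deriv u) t = f t (u t)) : ContDiff ℝ ∞ u := by
  refine contDiff_infty.2 fun n => ?_
  induction n with
  | zero => exact hu.of_le zero_le_two
  | succ n ih =>
    have hderiv2 : ContDiff ℝ n (deriv (deriv u)) := by
      rw [funext hode]
      exact (hf.of_le (by exact_mod_cast le_top)).comp (contDiff_id.prodMk ih)
    have hderiv : ContDiff ℝ (n + 1) (deriv u) :=
      contDiff_succ_iff_deriv.2 ⟨hu.differentiable_deriv_two, by simp, hderiv2⟩
    exact contDiff_succ_iff_deriv.2
      ⟨hu.differentiable two_ne_zero, by simp, hderiv.of_le le_self_add⟩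

theorem periodic_deriv {E : Type*} [NormedAddCommGroup E] [NormedSpace ℝ E] {h : ℝ → E} {T : ℝ}
    (hp : Function.Periodic h T) : Function.Periodic (deriv h) T := fun t => by
  rw [← deriv_comp_add_const, funext hp]

theorem injective_of_deriv_ne_zero {θ : ℝ → ℝ} (h : ∀ x, deriv θ x ≠ 0) :
    Function.Injective θ := by
  have hθ : Continuous θ :=
    continuous_iff_continuousAt.2 fun x => (differentiableAt_of_deriv_ne_zero (h x)).continuousAt
  refine .of_lt_imp_ne fun x y hxy heq => ?_
  obtain ⟨z, -, hz⟩ := exists_deriv_eq_zero hxy hθ.continuousOn heq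
  exact h z hz

theorem exists_forall_abs_sq_mul_sub_mul_lt_one {ι : Type*} {p q : ι → ℝ}
    (hp : Bornology.IsBounded (range p)) (hq : Bornology.IsBounded (range q)) :
    ∃ c > 0, ∀ a b : ℝ, |a| < c → |b| < c → ∀ x, |a ^ 2 * p x - b * q x| < 1 := by
  obtain ⟨P, hP⟩ := hp.exists_norm_le
  obtain ⟨Q, hQ⟩ := hq.exists_norm_le
  have hden : 0 < 1 + |P| + |Q| := by positivity
  refine ⟨(1 + |P| + |Q|)⁻¹, inv_pos.2 hden, fun a b ha hb x => ?_⟩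
  set c := (1 + |P| + |Q|)⁻¹
  have hc0 : 0 < c := inv_pos.2 hden
  have hc1 : c ≤ 1 := inv_le_one_of_one_le₀ (by linarith [abs_nonneg P, abs_nonneg Q])
  have hsq : |a ^ 2| ≤ c := by
    rw [abs_pow]
    exact (pow_le_of_le_one (abs_nonneg a) (ha.le.trans hc1) two_ne_zero).trans ha.le
  have hpx : |p x| ≤ |P| := (hP _ (mem_range_self x)).trans (le_abs_self P)
  have hqx : |q x| ≤ |Q| := (hQ _ (mem_range_self x)).trans (le_abs_self Q)
  calc |a ^ 2 * p x - b * q x| ≤ |a ^ 2| * |p x| + |b| * |q x| := by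
        rw [← abs_mul, ← abs_mul]
        exact abs_sub _ _
    _ ≤ c * |P| + c * |Q| := by gcongr
    _ < c * (1 + |P| + |Q|) := by linarith
    _ = 1 := inv_mul_cancel₀ hden.ne'

/-- The signed curvature of the unit speed plane curve `s ↦ (ξ s, η s)`. -/
noncomputable def curvature (ξ η : ℝ → ℝ) (s : ℝ) : ℝ :=
  deriv ξ s * deriv (deriv η) s - deriv η s * deriv (deriv ξ) s

/-- The signed radius of curvature; it takes the junk value `0` where the curvature vanishes. -/
noncomputable def curvatureRadius (ξ η : ℝ → ℝ) (s : ℝ) : ℝ :=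
  (curvature ξ η s)⁻¹

/-- `s ↦ (ξ s, η s)` is a smooth unit speed plane curve without inflection points; it need be
neither closed nor simple. -/
structure IsLocallyConvexCurve (ξ η : ℝ → ℝ) : Prop where
  smooth_fst : ContDiff ℝ ∞ ξ
  smooth_snd : ContDiff ℝ ∞ η
  unit_speed : ∀ s, deriv ξ s ^ 2 + deriv η s ^ 2 = 1
  curvature_ne_zero : ∀ s, curvature ξ η s ≠ 0

/-- The right-hand side of the equation of motion, solved for the acceleration `s''`. -/
noncomputable def motionForce (ξ η φ : ℝ → ℝ) (t x : ℝ) : ℝ :=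
  verticalSlope ξ η (φ t) x
    - deriv (deriv φ) t * (ξ x * deriv η x - η x * deriv ξ x)
    + deriv φ t ^ 2 * (ξ x * deriv ξ x + η x * deriv η x)

/-- The difference between the inertial part of `motionForce` at the parameter `x` and the
acceleration `R R' φ'² - R φ''` of a point of constant vertical slope `±1`, where `R` is the signed
radius of curvature. -/
noncomputable def inertialDefect (ξ η φ : ℝ → ℝ) (t x : ℝ) : ℝ :=
  deriv φ t ^ 2 * (ξ x * deriv ξ x + η x * deriv η x
      - curvatureRadius ξ η x * deriv (curvatureRadius ξ η) x)
    - deriv (deriv φ) t * (ξ x * deriv η x - η x * deriv ξ x - curvatureRadius ξ η x)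

section RotatingCurve

variable {ξ η φ s s₁ s₂ : ℝ → ℝ} {T ℓ σ : ℝ}

@[fun_prop]
theorem contDiff_infty_deriv {h : ℝ → ℝ} (hh : ContDiff ℝ ∞ h) : ContDiff ℝ ∞ (deriv h) :=
  (contDiff_infty_iff_deriv.1 hh).2

theorem contDiff_curvature (hξ : ContDiff ℝ ∞ ξ) (hη : ContDiff ℝ ∞ η) :
    ContDiff ℝ ∞ (curvature ξ η) :=
  (by fun_prop :
    ContDiff ℝ ∞ fun s => deriv ξ s * deriv (deriv η) s - deriv η s * deriv (deriv ξ) s)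

theorem IsLocallyConvexCurve.contDiff_curvatureRadius (h : IsLocallyConvexCurve ξ η) :
    ContDiff ℝ ∞ (curvatureRadius ξ η) :=
  (contDiff_curvature h.smooth_fst h.smooth_snd).inv h.curvature_ne_zero

theorem periodic_curvatureRadius (hξ : Function.Periodic ξ ℓ) (hη : Function.Periodic η ℓ) :
    Function.Periodic (curvatureRadius ξ η) ℓ := fun x => by
  simp only [curvatureRadius, curvature, periodic_deriv hξ x, periodic_deriv hη x,
    periodic_deriv (periodic_deriv hξ) x, periodic_deriv (periodic_deriv hη) x]

theorem contDiff_motionForce (hξ : ContDiff ℝ ∞ ξ) (hη : ContDiff ℝ ∞ η) (hφ : ContDiff ℝ ∞ φ) :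
    ContDiff ℝ ∞ (Function.uncurry (motionForce ξ η φ)) := by
  unfold Function.uncurry motionForce verticalSlope
  fun_prop

theorem periodic_motionForce (hφ : Function.Periodic φ T) :
    Function.Periodic (motionForce ξ η φ) T := fun t => by
  funext x
  simp only [motionForce, hφ t, periodic_deriv hφ t, periodic_deriv (periodic_deriv hφ) t]

theorem isRotatingCurveSolution_of_deriv_deriv_eq (hs : ContDiff ℝ ∞ s)
    (hode : ∀ t, deriv (deriv s) t = motionForce ξ η φ t (s t)) :
    IsRotatingCurveSolution ξ η φ s := by
  refine ⟨hs, fun t => ?_⟩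
  rw [hode, motionForce]
  ring

theorem tangent_eq_of_verticalSlope_eq {a x : ℝ} (hspeed : deriv ξ x ^ 2 + deriv η x ^ 2 = 1)
    (hσ : σ ^ 2 = 1) (h : verticalSlope ξ η a x = σ) :
    deriv ξ x = σ * Real.sin a ∧ deriv η x = σ * Real.cos a := by
  have hsum : (deriv ξ x - σ * Real.sin a) ^ 2 + (deriv η x - σ * Real.cos a) ^ 2 = 0 := by
    rw [verticalSlope] at h
    linear_combination hspeed - 2 * σ * h - hσ + σ ^ 2 * Real.sin_sq_add_cos_sq a
  rw [add_eq_zero_iff_of_nonneg (sq_nonneg _) (sq_nonneg _), sq_eq_zero_iff, sq_eq_zero_iff,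
    sub_eq_zero, sub_eq_zero] at hsum
  exact hsum

theorem IsLocallyConvexCurve.curvature_mul_deriv_of_verticalSlope_eq
    (h : IsLocallyConvexCurve ξ η) (hφ : Differentiable ℝ φ) (hs : Differentiable ℝ s)
    (hσ : σ ^ 2 = 1) (hv : ∀ t, verticalSlope ξ η (φ t) (s t) = σ) (t : ℝ) :
    curvature ξ η (s t) * deriv s t = -deriv φ t := by
  have htangent := fun t => tangent_eq_of_verticalSlope_eq (h.unit_speed (s t)) hσ (hv t)
  have hcomp {g : ℝ → ℝ} (hg : ContDiff ℝ ∞ g) :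
      HasDerivAt (fun t => deriv g (s t)) (deriv (deriv g) (s t) * deriv s t) t :=
    ((contDiff_infty_deriv hg).differentiable (by simp) (s t)).hasDerivAt.comp t
      (hs t).hasDerivAt
  have hsin : deriv (deriv ξ) (s t) * deriv s t = σ * (Real.cos (φ t) * deriv φ t) := by
    refine (hcomp h.smooth_fst).unique ?_
    rw [funext fun t => (htangent t).1]
    exact (hφ t).hasDerivAt.sin.const_mul σ
  have hcos : deriv (deriv η) (s t) * deriv s t = σ * (-Real.sin (φ t) * deriv φ t) := by
    refine (hcomp h.smooth_snd).unique ?_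
    rw [funext fun t => (htangent t).2]
    exact (hφ t).hasDerivAt.cos.const_mul σ
  rw [curvature, (htangent t).1, (htangent t).2]
  linear_combination σ * Real.sin (φ t) * hcos - σ * Real.cos (φ t) * hsin -
    (deriv φ t * (Real.sin (φ t) ^ 2 + Real.cos (φ t) ^ 2)) * hσ -
    deriv φ t * Real.sin_sq_add_cos_sq (φ t)

theorem IsLocallyConvexCurve.periodic_of_verticalSlope_eq (h : IsLocallyConvexCurve ξ η)
    (hφ : Differentiable ℝ φ) (hφp : Function.Periodic φ T) (hs : Differentiable ℝ s)
    (hσ : σ ^ 2 = 1) (hv : ∀ t, verticalSlope ξ η (φ t) (s t) = σ) : Function.Periodic s T := by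
  -- `θ` is the tangent angle of the curve, so that `θ (s t) + φ t` is constant.
  let θ : ℝ → ℝ := fun x => ∫ y in (0 : ℝ)..x, curvature ξ η y
  have hθ (x : ℝ) : HasDerivAt θ (curvature ξ η x) x :=
    ((contDiff_curvature h.smooth_fst h.smooth_snd).continuous.integral_hasStrictDerivAt 0
      x).hasDerivAt
  have hinj : Function.Injective θ :=
    injective_of_deriv_ne_zero fun x => (hθ x).deriv.trans_ne (h.curvature_ne_zero x)
  have hderiv (t : ℝ) : HasDerivAt (fun t => θ (s t) + φ t) 0 t := by
    refine (((hθ (s t)).comp t (hs t).hasDerivAt).add (hφ t).hasDerivAt).congr_deriv ?_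
    rw [h.curvature_mul_deriv_of_verticalSlope_eq hφ hs hσ hv, neg_add_cancel]
  intro t
  have hconst : θ (s (t + T)) + φ (t + T) = θ (s t) + φ t :=
    is_const_of_deriv_eq_zero (fun t => (hderiv t).differentiableAt) (fun t => (hderiv t).deriv) _ _
  rw [hφp] at hconst
  exact hinj (add_right_cancel hconst)

theorem IsLocallyConvexCurve.deriv_eq_of_verticalSlope_eq (h : IsLocallyConvexCurve ξ η)
    (hφ : Differentiable ℝ φ) (hs : Differentiable ℝ s) (hσ : σ ^ 2 = 1)
    (hv : ∀ t, verticalSlope ξ η (φ t) (s t) = σ) :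
    deriv s = fun t => -(curvatureRadius ξ η (s t) * deriv φ t) := by
  funext t
  rw [← mul_neg, ← h.curvature_mul_deriv_of_verticalSlope_eq hφ hs hσ hv, curvatureRadius,
    inv_mul_cancel_left₀ (h.curvature_ne_zero (s t))]

theorem IsLocallyConvexCurve.deriv_deriv_of_verticalSlope_eq (h : IsLocallyConvexCurve ξ η)
    (hφ : ContDiff ℝ 2 φ) (hs : Differentiable ℝ s) (hσ : σ ^ 2 = 1)
    (hv : ∀ t, verticalSlope ξ η (φ t) (s t) = σ) (t : ℝ) :
    deriv (deriv s) t =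
      deriv φ t ^ 2 * (curvatureRadius ξ η (s t) * deriv (curvatureRadius ξ η) (s t))
        - deriv (deriv φ) t * curvatureRadius ξ η (s t) := by
  have hs' := h.deriv_eq_of_verticalSlope_eq (hφ.differentiable two_ne_zero) hs hσ hv
  have hR : HasDerivAt (fun t => curvatureRadius ξ η (s t))
      (deriv (curvatureRadius ξ η) (s t) * deriv s t) t :=
    (h.contDiff_curvatureRadius.differentiable (by simp) (s t)).hasDerivAt.comp t (hs t).hasDerivAt
  rw [congrFun hs' t] at hR
  rw [hs']
  refine ((hR.mul (hφ.differentiable_deriv_two t).hasDerivAt).neg.congr_deriv ?_).deriv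
  ring

theorem IsLocallyConvexCurve.motionForce_sub_deriv_deriv_of_verticalSlope_eq
    (h : IsLocallyConvexCurve ξ η) (hφ : ContDiff ℝ 2 φ) (hs : Differentiable ℝ s) (hσ : σ ^ 2 = 1)
    (hv : ∀ t, verticalSlope ξ η (φ t) (s t) = σ) (t : ℝ) :
    motionForce ξ η φ t (s t) - deriv (deriv s) t = σ + inertialDefect ξ η φ t (s t) := by
  rw [motionForce, hv t, h.deriv_deriv_of_verticalSlope_eq hφ hs hσ hv t, inertialDefect]
  ring

theorem IsLocallyConvexCurve.isStrictLowerSolution (h : IsLocallyConvexCurve ξ η)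
    (hφ : ContDiff ℝ 2 φ) (hφp : Function.Periodic φ T) (hs : ContDiff ℝ 2 s)
    (hv : ∀ t, verticalSlope ξ η (φ t) (s t) = -1)
    (hdefect : ∀ t x, |inertialDefect ξ η φ t x| < 1) :
    IsStrictLowerSolution T (motionForce ξ η φ) s where
  contDiff := hs
  periodic := h.periodic_of_verticalSlope_eq (hφ.differentiable two_ne_zero) hφp
    (hs.differentiable two_ne_zero) neg_one_sq hv
  lt_deriv_deriv t := by
    have := h.motionForce_sub_deriv_deriv_of_verticalSlope_eq hφ
      (hs.differentiable two_ne_zero) neg_one_sq hv t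
    linarith [(abs_lt.1 (hdefect t (s t))).2]

theorem IsLocallyConvexCurve.isStrictUpperSolution (h : IsLocallyConvexCurve ξ η)
    (hφ : ContDiff ℝ 2 φ) (hφp : Function.Periodic φ T) (hs : ContDiff ℝ 2 s)
    (hv : ∀ t, verticalSlope ξ η (φ t) (s t) = 1)
    (hdefect : ∀ t x, |inertialDefect ξ η φ t x| < 1) :
    IsStrictUpperSolution T (motionForce ξ η φ) s where
  contDiff := hs
  periodic := h.periodic_of_verticalSlope_eq (hφ.differentiable two_ne_zero) hφp
    (hs.differentiable two_ne_zero) (one_pow 2) hv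
  deriv_deriv_lt t := by
    have := h.motionForce_sub_deriv_deriv_of_verticalSlope_eq hφ
      (hs.differentiable two_ne_zero) (one_pow 2) hv t
    linarith [(abs_lt.1 (hdefect t (s t))).1]

theorem IsLocallyConvexCurve.exists_isRotatingCurveSolution_between (h : IsLocallyConvexCurve ξ η)
    (hT : 0 < T) (hφ : ContDiff ℝ ∞ φ) (hφp : Function.Periodic φ T)
    (hs : IsVerticalTangentPair ξ η φ s₁ s₂) (hdefect : ∀ t x, |inertialDefect ξ η φ t x| < 1) :
    ∃ s, IsRotatingCurveSolution ξ η φ s ∧ Function.Periodic s T ∧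
      ∀ t, s₁ t < s t ∧ s t < s₂ t := by
  have hforce := contDiff_motionForce h.smooth_fst h.smooth_snd hφ
  have hφ2 : ContDiff ℝ 2 φ := contDiff_infty.1 hφ 2
  obtain ⟨s, hs2, hode, hsp, hbetween⟩ := exists_periodic_solution_between hT
    (contDiff_infty.1 hforce 1) (periodic_motionForce hφp)
    (h.isStrictLowerSolution hφ2 hφp (contDiff_infty.1 hs.smooth_left 2) hs.left_eq hdefect)
    (h.isStrictUpperSolution hφ2 hφp (contDiff_infty.1 hs.smooth_right 2) hs.right_eq hdefect)
    fun t => (hs.lt t).le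
  exact ⟨s, isRotatingCurveSolution_of_deriv_deriv_eq
    (contDiff_infty_of_deriv_deriv_eq hforce hs2 hode) hode, hsp, hbetween⟩

theorem IsLocallyConvexCurve.exists_forall_abs_inertialDefect_lt_one
    (h : IsLocallyConvexCurve ξ η) (hℓ : ℓ ≠ 0) (hξ : Function.Periodic ξ ℓ)
    (hη : Function.Periodic η ℓ) :
    ∃ c > 0, ∀ (φ : ℝ → ℝ) (t : ℝ), |deriv φ t| < c → |deriv (deriv φ) t| < c →
      ∀ x, |inertialDefect ξ η φ t x| < 1 := by
  have hξc := h.smooth_fst.continuous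
  have hηc := h.smooth_snd.continuous
  have hξ'c := (contDiff_infty_deriv h.smooth_fst).continuous
  have hη'c := (contDiff_infty_deriv h.smooth_snd).continuous
  have hRc := h.contDiff_curvatureRadius.continuous
  have hR'c := (contDiff_infty_deriv h.contDiff_curvatureRadius).continuous
  have hξ' := periodic_deriv hξ
  have hη' := periodic_deriv hη
  have hR := periodic_curvatureRadius hξ hη
  obtain ⟨c, hc, hsmall⟩ := exists_forall_abs_sq_mul_sub_mul_lt_one
    ((((hξ.mul hξ').add (hη.mul hη')).sub (hR.mul (periodic_deriv hR))).isBounded_of_continuous hℓ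
      (((hξc.mul hξ'c).add (hηc.mul hη'c)).sub (hRc.mul hR'c)))
    ((((hξ.mul hη').sub (hη.mul hξ')).sub hR).isBounded_of_continuous hℓ
      (((hξc.mul hη'c).sub (hηc.mul hξ'c)).sub hRc))
  exact ⟨c, hc, fun φ t h₁ h₂ => hsmall _ _ h₁ h₂⟩

end RotatingCurve

theorem IsStrictlyConvexClosedCurve.isLocallyConvexCurve {ξ η : ℝ → ℝ} {ℓ : ℝ}
    (h : IsStrictlyConvexClosedCurve ξ η ℓ) : IsLocallyConvexCurve ξ η :=
  ⟨h.smooth_fst, h.smooth_snd, h.unit_speed, h.curvature_ne_zero⟩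

theorem lemma3p7_general (ξ η : ℝ → ℝ) (ℓ : ℝ) (hℓ : ℓ ≠ 0) (hcurve : IsLocallyConvexCurve ξ η)
    (hξ : Function.Periodic ξ ℓ) (hη : Function.Periodic η ℓ) :
    ∃ c : ℝ, 0 < c ∧
      ∀ (T : ℝ) (φ : ℝ → ℝ), 0 < T → ContDiff ℝ ∞ φ → Function.Periodic φ T →
        (∀ t, |deriv φ t| < c ∧ |deriv (deriv φ) t| < c) →
        ∀ s₁ s₂ : ℝ → ℝ, IsVerticalTangentPair ξ η φ s₁ s₂ →
          ∃ s : ℝ → ℝ, IsRotatingCurveSolution ξ η φ s ∧ Function.Periodic s T ∧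
            ∀ t, s₁ t < s t ∧ s t < s₂ t := by
  obtain ⟨c, hc, hdefect⟩ := hcurve.exists_forall_abs_inertialDefect_lt_one hℓ hξ hη
  exact ⟨c, hc, fun T φ hT hφ hφp hslow s₁ s₂ hs =>
    hcurve.exists_isRotatingCurveSolution_between hT hφ hφp hs
      fun t => hdefect φ t (hslow t).1 (hslow t).2⟩

theorem lemma3p7 (ξ η : ℝ → ℝ) (ℓ : ℝ) (hcurve : IsStrictlyConvexClosedCurve ξ η ℓ) :
    ∃ c : ℝ, 0 < c ∧
      ∀ (T : ℝ) (φ : ℝ → ℝ), 0 < T → ContDiff ℝ ∞ φ → Function.Periodic φ T →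
        (∀ t, |deriv φ t| < c ∧ |deriv (deriv φ) t| < c) →
        ∀ s₁ s₂ : ℝ → ℝ, IsVerticalTangentPair ξ η φ s₁ s₂ →
          ∃ s : ℝ → ℝ, IsRotatingCurveSolution ξ η φ s ∧ Function.Periodic s T ∧
            ∀ t, s₁ t < s t ∧ s t < s₂ t :=
  lemma3p7_general ξ η ℓ hcurve.length_pos.ne' hcurve.isLocallyConvexCurve hcurve.periodic_fst
    hcurve.periodic_snd
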